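/- Let $E$ be a finite-dimensional real normed space of dimension at least $1$ (for instance $\mathbb{R}^n$, $n\ge 1$), and let $C\subset E$ be a proper cone (convex, closed, $C\cap(-C)=\{0\}$, nonempty interior). Write $x\le_C y$ for $y-x\in C$, and equip $\operatorname{int} C$ with the Funk hemi-metric $$\operatorname{Funk}(x,y)=\log\inf\{\alpha>0 \mid x\le_C \alpha y\}.$$ Let $\mathcal A,\mathcal B$ be nonempty compact topological spaces, and let $(T_{ab})_{(a,b)\in\mathcal A\times\mathcal B}$ be a family of self-maps of $\operatorname{int} C$ that are order-preserving ($x\le_C y$ implies $T_{ab}(x)\le_C T_{ab}(y)$) and positively homogeneous ($T_{ab}(tx)=t\,T_{ab}(x)$ for $t>0$). Assume that each $T_{ab}$ extends to a self-map of $C$, still denoted $T_{ab}$, such that $(a,b,x)\mapsto T_{ab}(x)$ is continuous from $\mathcal A\times\mathcal B\times C$ to $C$ for the norm topology on $C$. In the escape rate game with initial state $x_0\in\operatorname{int} C$, at each turn $k\ge1$ player Min chooses $a_k\in\mathcal A$, then player Max, having observed $a_k$, chooses $b_k\in\mathcal B$, and the state becomes $x_k=T_{a_kb_k}(x_{k-1})$;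 strategies may depend on the whole past history of states and actions. If Min uses the strategy $\sigma$ and Max uses the strategy $\tau$, put $J_k(\sigma,\tau)=\operatorname{Funk}(x_k,x_0)$; Min wants to minimize and Max to maximize this payoff. A real number $\rho$ is the (uniform) value of the game if for every $\varepsilon>0$ there are strategies $\sigma_\varepsilon,\tau_\varepsilon$ and $N\in\mathbb N$ such that for all $k\ge N$ and all strategies $\sigma,\tau$, $$\frac{J_k(\sigma_\varepsilon,\tau)}{k}\le\rho+\varepsilon,\qquad \frac{J_k(\sigma,\tau_\varepsilon)}{k}\ge\rho-\varepsilon .$$ Let $\mathscr D_C$ be the set of continuous functions $v:C\to[-\infty,+\infty]$ whose restriction to $\operatorname{int} C$ is real-valued and distance-like, that is, $v(x)-v(y)\le\operatorname{Funk}(x,y)$ for all $x,y\in\operatorname{int} C$, and there exist $z\in\operatorname{int} C$ and $\alpha\in\mathbb R$ with $v(x)\ge\alpha+\operatorname{Funk}(x,z)$ for all $x\in\operatorname{int} C$. (Such a $v$ is automatically finite on $C\setminus\{0\}$, with $v(0)=-\infty$.) For $v\in\mathscr D_C$ and $x\in C$ put $$Sv(x)=\inf_{a\in\mathcal A}\sup_{b\in\mathcal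 B}v(T_{ab}(x)).$$ Then the game has a value $\rho\in\mathbb R$, and $$\rho=\inf\{\lambda\in\mathbb R \mid \exists\, v\in\mathscr D_C,\ Sv\le\lambda+v \text{ on } C\},$$ where the set on the right-hand side is nonempty and bounded below. -/

import Mathlib

noncomputable section

namespace EscapeRate

/-! ### Escape rate games on a space `X` with a real-valued (asymmetric) distance `d` -/

section Game

variable {X A B : Type*}

/-- Strategies of Min: the next action as a function of the past
`(x₀, a₁, b₁), …, (x_{k-1}, a_k, b_k)` and of the current state `x_k`. -/
abbrev MinStrategy (X A B : Type*) := List (X × A × B) → X → A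

/-- Strategies of Max: the next action as a function of the past, of the current state, and of
the action just chosen by Min. -/
abbrev MaxStrategy (X A B : Type*) := List (X × A × B) → X → A → B

/-- The past and the current state after `k` turns, when the players use `σ` and `τ` from the
initial state `x₀`. -/
def play (T : A → B → X → X) (x₀ : X) (σ : MinStrategy X A B) (τ : MaxStrategy X A B) :
    ℕ → List (X × A × B) × X
  | 0 => ([], x₀)
  | k + 1 =>
    let h := (play T x₀ σ τ k).1
    let x := (play T x₀ σ τ k).2
    let a := σ h x
    let b := τ h x a
    (h ++ [(x, a, b)], T a b x)

/-- The payoff `J_k(σ, τ) = d(x_k, x₀)` of the game in horizon `k`. -/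
def payoff (d : X → X → ℝ) (T : A → B → X → X) (x₀ : X)
    (σ : MinStrategy X A B) (τ : MaxStrategy X A B) (k : ℕ) : ℝ :=
  d (play T x₀ σ τ k).2 x₀

/-- `ρ` is the uniform value of the escape rate game with initial state `x₀`. -/
def IsUniformValue (d : X → X → ℝ) (T : A → B → X → X) (x₀ : X) (ρ : ℝ) : Prop :=
  ∀ ε : ℝ, 0 < ε → ∃ (σε : MinStrategy X A B) (τε : MaxStrategy X A B) (N : ℕ),
    ∀ k : ℕ, N ≤ k → ∀ (σ : MinStrategy X A B) (τ : MaxStrategy X A B),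
      payoff d T x₀ σε τ k / k ≤ ρ + ε ∧ ρ - ε ≤ payoff d T x₀ σ τε k / k

/-- A function which is `1`-Lipschitz from `(X, d)` to `ℝ` with `δ₁(s, t) = s - t`, and bounded
below by `d(·, x₀)` up to an additive constant, for some point `x₀`. -/
def IsDistanceLike (d : X → X → ℝ) (f : X → ℝ) : Prop :=
  (∀ x y : X, f x - f y ≤ d x y) ∧ ∃ (x₀ : X) (α : ℝ), ∀ x : X, α + d x x₀ ≤ f x

end Game

/-! ### Cones -/

section Cone

variable {E : Type*} [NormedAddCommGroup E] [NormedSpace ℝ E]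

/-- A proper cone: convex, closed, with `C ∩ -C = {0}`, and of nonempty interior. -/
structure IsProperCone (C : ConvexCone ℝ E) : Prop where
  isClosed : IsClosed (C : Set E)
  salient : C.Salient
  nonempty_interior : (interior (C : Set E)).Nonempty

/-- The Funk hemi-metric `log inf {α > 0 | y ≤_C α z}` on the interior of `C`, where
`y ≤_C z` means `z - y ∈ C`. -/
def funk (C : ConvexCone ℝ E) (y z : interior (C : Set E)) : ℝ :=
  Real.log (sInf {α : ℝ | 0 < α ∧ α • (z : E) - (y : E) ∈ C})

/-- The space `𝒟_C`: functions that are continuous on `C` (for the norm topology), and that are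
finite and distance-like for the Funk metric on the interior of `C`. The values are taken in
the extended reals because such a function equals `-∞` at the apex `0` of the cone. Only the
values on `C` matter. -/
def distanceLikeOnCone (C : ConvexCone ℝ E) : Set (E → EReal) :=
  {v | ContinuousOn v (C : Set E) ∧
    ∃ f : interior (C : Set E) → ℝ, IsDistanceLike (funk C) f ∧
      ∀ x : interior (C : Set E), v (x : E) = (f x : EReal)}

/-- The Shapley operator `Sv(x) = inf_a sup_b v(T_{ab}(x))`. -/
def shapley {A B : Type*} (T : A → B → E → E) (v : E → EReal) (x : E) : EReal :=
  ⨅ a : A, ⨆ b : B, v (T a b x)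

end Cone

end EscapeRate

end

/-! Exponentiate the game. Let `V 0 = coneRatio C · z` and let `V (n+1)` be the inf-sup of `V n`
after one turn. Each `V n` is continuous, monotone and homogeneous, hence `V n x ≤ coneRatio C x z *
V n z`, which makes `V n z` submultiplicative. By Fekete `log (V n z) / n` has a limit `r`, finite
because compactness bounds the one-turn decrease. This `r` is the value.

Min, `l > r`: choose `n` with `V n z < exp (n l)` and take the minimum over `k < n` of `exp (-k l) *
V k`. One turn lowers the index by one, and index `0` closes the cycle through `V n ≤ exp (n l) * V
0`. A small multiple of `K ^ k * coneRatio C · z` added to each `V k` makes the logarithm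
distance-like (`exists_shapley_le`). Any such subsolution bounds the payoff, up to a constant
absorbed over long horizons.

Max, `m < r`: `log (V n z) - n m` tends to infinity, so it has infinitely many record times `n`, at
which `V (n - j) z ≤ exp (-j m) * V n z`. Limits `u j` of `V (n - j) / V n z` along an ultrafilter
of record times turn the optimal actions of all these horizons into one strategy keeping `u`
nondecreasing (`exists_limit_horizonValue`). Starting from `u 0 x₀ = 1`, this forces growth at rate
at least `m`. -/

open Set Filter Topology

namespace EscapeRate

/-! ### The Funk ratio and monotone homogeneous functions on a cone -/

section ConeRatio

variable {E : Type*} [NormedAddCommGroup E] [NormedSpace ℝ E] {C : ConvexCone ℝ E}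

/-- The exponential of the Funk hemi-metric: the least `α ≥ 0` with `y ≤_C α z`. -/
noncomputable def coneRatio (C : ConvexCone ℝ E) (y z : E) : ℝ :=
  sInf {α : ℝ | 0 < α ∧ α • z - y ∈ C}

lemma funk_eq_log (y z : interior (C : Set E)) : funk C y z = Real.log (coneRatio C y z) := rfl

lemma IsProperCone.zero_mem (hC : IsProperCone C) : (0 : E) ∈ C := by
  obtain ⟨e, he⟩ := hC.nonempty_interior
  have he : e ∈ C := interior_subset he
  have h : Tendsto (fun n : ℕ => (1 / ((n : ℝ) + 1)) • e) atTop (𝓝 ((0 : ℝ) • e)) :=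
    tendsto_one_div_add_atTop_nhds_zero_nat.smul_const e
  rw [zero_smul] at h
  exact hC.isClosed.mem_of_tendsto h (Eventually.of_forall fun n => C.smul_mem (by positivity) he)

lemma IsProperCone.smul_mem' (hC : IsProperCone C) {t : ℝ} (ht : 0 ≤ t) {x : E} (hx : x ∈ C) :
    t • x ∈ C := by
  rcases ht.eq_or_lt with rfl | ht
  · simpa using hC.zero_mem
  · exact C.smul_mem ht hx

/-- An interior point of a cone is an order unit, with a bound linear in the norm. -/
lemma IsProperCone.exists_norm_smul_sub_mem (hC : IsProperCone C) {z : E}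
    (hz : z ∈ interior (C : Set E)) : ∃ c : ℝ, 0 < c ∧ ∀ y : E, (c * ‖y‖) • z - y ∈ C := by
  obtain ⟨r, hr, hball⟩ := Metric.isOpen_iff.1 isOpen_interior z hz
  refine ⟨2 / r, by positivity, fun y => ?_⟩
  rcases eq_or_ne y 0 with rfl | hy
  · simpa using hC.zero_mem
  have hy' : 0 < ‖y‖ := norm_pos_iff.2 hy
  have h : z - (r / (2 * ‖y‖)) • y ∈ C := by
    refine interior_subset (hball ?_)
    rw [Metric.mem_ball, dist_eq_norm, sub_sub_cancel_left, norm_neg, norm_smul, Real.norm_eq_abs,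
      abs_of_pos (by positivity)]
    field_simp
    linarith
  have h2 := C.smul_mem (show 0 < 2 / r * ‖y‖ by positivity) h
  rw [smul_sub, smul_smul] at h2
  have : 2 / r * ‖y‖ * (r / (2 * ‖y‖)) = 1 := by field_simp
  rwa [this, one_smul] at h2

lemma IsProperCone.zero_notMem_interior [Nontrivial E] (hC : IsProperCone C) :
    (0 : E) ∉ interior (C : Set E) := by
  intro h
  obtain ⟨c, -, hc⟩ := hC.exists_norm_smul_sub_mem h
  obtain ⟨y, hy⟩ := exists_ne (0 : E)
  have h1 := hc y
  have h2 := hc (-y)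
  simp only [smul_zero, zero_sub, neg_neg] at h1 h2
  exact hC.salient y h2 hy h1

lemma coneRatio_nonneg (y z : E) : 0 ≤ coneRatio C y z :=
  Real.sInf_nonneg fun _ h => h.1.le

lemma coneRatio_le {y z : E} (hz : z ∈ C) {α : ℝ}
    (hα : 0 ≤ α) (h : α • z - y ∈ C) : coneRatio C y z ≤ α := by
  refine le_of_forall_pos_le_add fun ε hε => csInf_le ⟨0, fun _ h => h.1.le⟩ ⟨by positivity, ?_⟩
  have : (α + ε) • z - y = (α • z - y) + ε • z := by module
  rw [this]
  exact C.add_mem h (C.smul_mem hε hz)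

lemma IsProperCone.coneRatio_smul_sub_mem (hC : IsProperCone C) (y : E) {z : E}
    (hz : z ∈ interior (C : Set E)) : coneRatio C y z • z - y ∈ C := by
  have hne : {α : ℝ | 0 < α ∧ α • z - y ∈ C}.Nonempty := by
    obtain ⟨c, hc, h⟩ := hC.exists_norm_smul_sub_mem hz
    refine ⟨c * ‖y‖ + 1, by positivity, ?_⟩
    have : (c * ‖y‖ + 1) • z - y = ((c * ‖y‖) • z - y) + z := by module
    rw [this]
    exact C.add_mem (h y) (interior_subset hz)
  have hcl : IsClosed {α : ℝ | α • z - y ∈ C} :=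
    hC.isClosed.preimage (f := fun α : ℝ => α • z - y) (by fun_prop)
  exact closure_minimal (fun α hα => hα.2) hcl
    (csInf_mem_closure hne ⟨0, fun _ h => h.1.le⟩)

lemma IsProperCone.smul_sub_mem_of_coneRatio_le (hC : IsProperCone C) {y z : E}
    (hz : z ∈ interior (C : Set E)) {α : ℝ} (h : coneRatio C y z ≤ α) : α • z - y ∈ C := by
  have : α • z - y = (coneRatio C y z • z - y) + (α - coneRatio C y z) • z := by module
  rw [this]
  exact C.add_mem (hC.coneRatio_smul_sub_mem y hz)
    (hC.smul_mem' (sub_nonneg.2 h) (interior_subset hz))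

lemma IsProperCone.coneRatio_pos [Nontrivial E] (hC : IsProperCone C) {y z : E}
    (hy : y ∈ interior (C : Set E)) (hz : z ∈ interior (C : Set E)) : 0 < coneRatio C y z := by
  refine (coneRatio_nonneg y z).lt_of_ne fun h => ?_
  have h1 := hC.coneRatio_smul_sub_mem y hz
  rw [← h, zero_smul, zero_sub] at h1
  refine hC.salient y (interior_subset hy) ?_ h1
  rintro rfl
  exact hC.zero_notMem_interior hy

lemma IsProperCone.coneRatio_self [Nontrivial E] (hC : IsProperCone C) {z : E}
    (hz : z ∈ interior (C : Set E)) : coneRatio C z z = 1 := by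
  refine le_antisymm (coneRatio_le (interior_subset hz) zero_le_one
    (by simpa using hC.zero_mem)) ?_
  by_contra! hlt
  have h1 := hC.coneRatio_smul_sub_mem z hz
  -- A ratio below `1` would put a positive multiple of `-z`, hence `-z` itself, in `C`.
  have h2 := C.smul_mem (inv_pos.2 (sub_pos.2 hlt)) h1
  have h3 : (1 - coneRatio C z z)⁻¹ • (coneRatio C z z • z - z) = -z := by
    rw [show coneRatio C z z • z - z = (1 - coneRatio C z z) • (-z) by module, smul_smul,
      inv_mul_cancel₀ (sub_pos.2 hlt).ne', one_smul]
  rw [h3] at h2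
  refine hC.salient z (interior_subset hz) ?_ h2
  rintro rfl
  exact hC.zero_notMem_interior hz

/-- Nonnegative functions on a cone that are continuous, order-preserving and positively
homogeneous. -/
structure IsHomMono (C : ConvexCone ℝ E) (V : E → ℝ) : Prop where
  continuousOn : ContinuousOn V (C : Set E)
  nonneg : ∀ x ∈ C, 0 ≤ V x
  le_mul : ∀ x ∈ C, ∀ y ∈ C, ∀ α : ℝ, 0 < α → α • y - x ∈ C → V x ≤ α * V y

/-- In logarithms this is the 1-Lipschitz property for the Funk metric, and it is the basic estimate
of the whole proof. The ratio vanishes at `x = 0` while `le_mul` needs `α > 0`, hence the limit from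
the right. -/
lemma IsHomMono.le_coneRatio_mul {V : E → ℝ} (hV : IsHomMono C V) (hC : IsProperCone C) {x y : E}
    (hx : x ∈ C) (hy : y ∈ interior (C : Set E)) : V x ≤ coneRatio C x y * V y := by
  have hlim : Tendsto (fun ε : ℝ => (coneRatio C x y + ε) * V y) (𝓝[>] 0)
      (𝓝 ((coneRatio C x y + 0) * V y)) :=
    Tendsto.mono_left (Continuous.tendsto (by fun_prop) _) nhdsWithin_le_nhds
  rw [add_zero] at hlim
  refine ge_of_tendsto hlim ?_
  filter_upwards [self_mem_nhdsWithin] with ε hε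
  have hε : 0 < ε := hε
  exact hV.le_mul x hx y (interior_subset hy) _ (add_pos_of_nonneg_of_pos (coneRatio_nonneg x y) hε)
    (hC.smul_sub_mem_of_coneRatio_le hy (by linarith))

lemma IsProperCone.isHomMono_coneRatio (hC : IsProperCone C) {z : E}
    (hz : z ∈ interior (C : Set E)) : IsHomMono C (fun x => coneRatio C x z) where
  continuousOn := by
    obtain ⟨c, hc, h⟩ := hC.exists_norm_smul_sub_mem hz
    refine (LipschitzWith.of_le_add_mul ⟨c, hc.le⟩ fun x y => ?_).continuous.continuousOn
    rw [dist_eq_norm]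
    refine coneRatio_le (interior_subset hz)
      (add_nonneg (coneRatio_nonneg y z) (mul_nonneg hc.le (norm_nonneg _))) ?_
    have : (coneRatio C y z + c * ‖x - y‖) • z - x =
        (coneRatio C y z • z - y) + ((c * ‖x - y‖) • z - (x - y)) := by module
    exact this ▸ C.add_mem (hC.coneRatio_smul_sub_mem y hz) (h (x - y))
  nonneg x _ := coneRatio_nonneg x z
  le_mul x _ y _ α hα h := by
    refine coneRatio_le (interior_subset hz) (mul_nonneg hα.le (coneRatio_nonneg y z)) ?_
    have : (α * coneRatio C y z) • z - x = α • (coneRatio C y z • z - y) + (α • y - x) := by module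
    rw [this]
    exact C.add_mem (C.smul_mem hα (hC.coneRatio_smul_sub_mem y hz)) h

lemma IsProperCone.funk_triangle [Nontrivial E] (hC : IsProperCone C)
    (x y z : interior (C : Set E)) : funk C x z ≤ funk C x y + funk C y z := by
  simp only [funk_eq_log]
  rw [← Real.log_mul (hC.coneRatio_pos x.2 y.2).ne' (hC.coneRatio_pos y.2 z.2).ne']
  exact Real.log_le_log (hC.coneRatio_pos x.2 z.2)
    ((hC.isHomMono_coneRatio z.2).le_coneRatio_mul hC (interior_subset x.2) y.2)

lemma IsHomMono.add {V W : E → ℝ} (hV : IsHomMono C V) (hW : IsHomMono C W) :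
    IsHomMono C (fun x => V x + W x) where
  continuousOn := hV.continuousOn.add hW.continuousOn
  nonneg x hx := add_nonneg (hV.nonneg x hx) (hW.nonneg x hx)
  le_mul x hx y hy α hα h := by
    linarith [hV.le_mul x hx y hy α hα h, hW.le_mul x hx y hy α hα h]

lemma IsHomMono.const_mul {V : E → ℝ} (hV : IsHomMono C V) {c : ℝ} (hc : 0 ≤ c) :
    IsHomMono C (fun x => c * V x) where
  continuousOn := continuousOn_const.mul hV.continuousOn
  nonneg x hx := mul_nonneg hc (hV.nonneg x hx)
  le_mul x hx y hy α hα h := by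
    have := mul_le_mul_of_nonneg_left (hV.le_mul x hx y hy α hα h) hc
    linarith

lemma IsHomMono.finset_inf' {ι : Type*} {s : Finset ι} (hs : s.Nonempty) {V : ι → E → ℝ}
    (hV : ∀ i ∈ s, IsHomMono C (V i)) : IsHomMono C (fun x => s.inf' hs (fun i => V i x)) where
  continuousOn := ContinuousOn.finset_inf'_apply hs fun i hi => (hV i hi).continuousOn
  nonneg x hx := Finset.le_inf' _ _ fun i hi => (hV i hi).nonneg x hx
  le_mul x hx y hy α hα h := by
    obtain ⟨i, hi, hiy⟩ := s.exists_mem_eq_inf' hs (fun i => V i y)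
    rw [hiy]
    exact (s.inf'_le _ hi).trans ((hV i hi).le_mul x hx y hy α hα h)

/-- The logarithm of a continuous order-preserving homogeneous function, as an extended real
function, belongs to `𝒟_C` if it dominates a multiple of `exp Funk(·, z)`. -/
lemma IsHomMono.log_mem_distanceLikeOnCone [Nontrivial E] {V : E → ℝ} (hV : IsHomMono C V)
    (hC : IsProperCone C) (z : interior (C : Set E)) {c : ℝ} (hc : 0 < c)
    (h : ∀ x ∈ C, c * coneRatio C x z ≤ V x) :
    (fun x => ENNReal.log (ENNReal.ofReal (V x))) ∈ distanceLikeOnCone C := by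
  have hpos : ∀ x : interior (C : Set E), 0 < V x := fun x =>
    (mul_pos hc (hC.coneRatio_pos x.2 z.2)).trans_le (h x (interior_subset x.2))
  refine ⟨(ENNReal.continuous_log.comp ENNReal.continuous_ofReal).comp_continuousOn hV.continuousOn,
    fun x => Real.log (V x), ⟨fun x y => ?_, z, Real.log c, fun x => ?_⟩,
    fun x => ENNReal.log_ofReal_of_pos (hpos x)⟩
  · rw [sub_le_iff_le_add, funk_eq_log, ← Real.log_mul (hC.coneRatio_pos x.2 y.2).ne' (hpos y).ne']
    exact Real.log_le_log (hpos x) (hV.le_coneRatio_mul hC (interior_subset x.2) y.2)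
  · rw [funk_eq_log, ← Real.log_mul hc.ne' (hC.coneRatio_pos x.2 z.2).ne']
    exact Real.log_le_log (mul_pos hc (hC.coneRatio_pos x.2 z.2)) (h x (interior_subset x.2))

end ConeRatio

/-! ### Strategies built from one-turn inequalities -/

section Guarantee

variable {X A B : Type*}

lemma length_play (T : A → B → X → X) (x₀ : X) (σ : MinStrategy X A B) (τ : MaxStrategy X A B)
    (k : ℕ) : (play T x₀ σ τ k).1.length = k := by
  induction k with
  | zero => rfl
  | succ k ih => simp [play, ih]

/-- A strategy of Min keeping `f` from growing faster than `l` per turn. -/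
lemma exists_minStrategy (T : A → B → X → X) (f : X → ℝ) (l : ℝ)
    (h : ∀ x, ∃ a, ∀ b, f (T a b x) ≤ l + f x) (x₀ : X) :
    ∃ σ : MinStrategy X A B, ∀ (τ : MaxStrategy X A B) (k : ℕ),
      f (play T x₀ σ τ k).2 ≤ k * l + f x₀ := by
  choose s hs using h
  refine ⟨fun _ x => s x, fun τ k => ?_⟩
  induction k with
  | zero => simp [play]
  | succ k ih =>
    refine (hs _ _).trans ?_
    push_cast
    linarith

/-- A strategy of Max along which a time-dependent function does not decrease. -/
lemma exists_maxStrategy (T : A → B → X → X) (u : ℕ → X → ℝ)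
    (h : ∀ k x a, ∃ b, u k x ≤ u (k + 1) (T a b x)) (x₀ : X) :
    ∃ τ : MaxStrategy X A B, ∀ (σ : MinStrategy X A B) (k : ℕ),
      u 0 x₀ ≤ u k (play T x₀ σ τ k).2 := by
  choose t ht using h
  refine ⟨fun past x a => t past.length x a, fun σ k => ?_⟩
  induction k with
  | zero => exact le_rfl
  | succ k ih =>
    simp only [play, length_play]
    exact ih.trans (ht k _ _)

/-- Max's near-optimal strategy for one value is played against Min's near-optimal strategy for the
other. -/
lemma IsUniformValue.unique {d : X → X → ℝ} {T : A → B → X → X} {x₀ : X} {ρ ρ' : ℝ}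
    (h : IsUniformValue d T x₀ ρ) (h' : IsUniformValue d T x₀ ρ') : ρ = ρ' := by
  have key : ∀ r r' : ℝ, IsUniformValue d T x₀ r → IsUniformValue d T x₀ r' → r ≤ r' := by
    intro r r' hr hr'
    refine le_of_forall_pos_le_add fun ε hε => ?_
    obtain ⟨σ, τ, N, hN⟩ := hr (ε / 2) (half_pos hε)
    obtain ⟨σ', τ', N', hN'⟩ := hr' (ε / 2) (half_pos hε)
    have h1 := (hN (max N N') (le_max_left _ _) σ' τ).2
    have h2 := (hN' (max N N') (le_max_right _ _) σ τ).1
    linarith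
  exact le_antisymm (key _ _ h h') (key _ _ h' h)

end Guarantee

/-! ### Compact families of cone maps -/

section ConeFamily

variable {E : Type*} [NormedAddCommGroup E] [NormedSpace ℝ E] {C : ConvexCone ℝ E}
  {A B : Type*} [TopologicalSpace A] [TopologicalSpace B] {T : A → B → E → E}

/-- A continuous family of order-preserving and positively homogeneous self-maps of a cone
preserving its interior. -/
structure IsConeFamily (C : ConvexCone ℝ E) (T : A → B → E → E) : Prop where
  mem : ∀ a b, ∀ x ∈ C, T a b x ∈ C
  mem_interior : ∀ a b, ∀ x ∈ interior (C : Set E), T a b x ∈ interior (C : Set E)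
  smul_sub_mem : ∀ a b, ∀ x ∈ C, ∀ y ∈ C, ∀ α : ℝ, 0 < α → α • y - x ∈ C →
    α • T a b y - T a b x ∈ C
  continuousOn : ContinuousOn (fun p : A × B × E => T p.1 p.2.1 p.2.2) {p | p.2.2 ∈ C}

/-- Monotonicity and homogeneity extend from the interior to the whole cone by continuity. -/
lemma IsProperCone.isConeFamily (hC : IsProperCone C)
    (hT_cone : ∀ a b, Set.MapsTo (T a b) (C : Set E) (C : Set E))
    (hT_int : ∀ a b, Set.MapsTo (T a b) (interior (C : Set E)) (interior (C : Set E)))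
    (hT_mono : ∀ a b, ∀ x ∈ interior (C : Set E), ∀ y ∈ interior (C : Set E),
      y - x ∈ C → T a b y - T a b x ∈ C)
    (hT_homog : ∀ a b, ∀ x ∈ interior (C : Set E), ∀ t : ℝ, 0 < t →
      T a b (t • x) = t • T a b x)
    (hT_cont : ContinuousOn (fun p : A × B × E => T p.1 p.2.1 p.2.2)
      {p : A × B × E | p.2.2 ∈ C}) : IsConeFamily C T where
  mem a b x hx := hT_cone a b hx
  mem_interior a b x hx := hT_int a b hx
  continuousOn := hT_cont
  smul_sub_mem a b x hx y hy α hα h := by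
    obtain ⟨e, he⟩ := hC.nonempty_interior
    have hadd : ∀ z ∈ C, ∀ t : ℝ, 0 < t → z + t • e ∈ interior (C : Set E) := by
      intro z hz t ht
      have hopen : IsOpen ((fun w => z + t • w) '' interior (C : Set E)) :=
        ((Homeomorph.smulOfNeZero t ht.ne').trans (Homeomorph.addLeft z)).isOpenMap _
          isOpen_interior
      refine interior_maximal ?_ hopen ⟨e, he, rfl⟩
      rintro _ ⟨w, hw, rfl⟩
      exact C.add_mem hz (C.smul_mem ht (interior_subset hw))
    have hc : ContinuousOn (T a b) (C : Set E) :=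
      hT_cont.comp (f := fun x : E => (a, b, x)) (by fun_prop) fun x hx => hx
    have hlim : ∀ z ∈ C, ∀ s : ℝ, 0 < s →
        Tendsto (fun t : ℝ => T a b (z + (t * s) • e)) (𝓝[>] 0) (𝓝 (T a b z)) := by
      intro z hz s hs
      refine (hc z hz).tendsto.comp (tendsto_nhdsWithin_iff.2 ⟨?_, ?_⟩)
      · have : Tendsto (fun t : ℝ => z + (t * s) • e) (𝓝 0) (𝓝 (z + ((0 : ℝ) * s) • e)) :=
          Continuous.tendsto (by fun_prop) _
        rw [zero_mul, zero_smul, add_zero] at this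
        exact this.mono_left nhdsWithin_le_nhds
      · filter_upwards [self_mem_nhdsWithin] with t ht
        exact interior_subset (hadd z hz _ (mul_pos ht hs))
    -- Both points are pushed into the interior along `e`. The offsets `t` for `y` and `t * α` for
    -- `x` cancel in `α • y - x`, so the order relation is preserved exactly before `t` tends to
    -- `0`.
    refine hC.isClosed.mem_of_tendsto
      (((hlim y hy 1 one_pos).const_smul α).sub (hlim x hx α hα)) ?_
    filter_upwards [self_mem_nhdsWithin] with t ht
    have ht : 0 < t := ht
    have hy' := hadd y hy (t * 1) (by positivity)
    rw [← hT_homog a b _ hy' α hα]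
    have hαy : α • (y + (t * 1) • e) ∈ interior (C : Set E) := by
      rw [show α • (y + (t * 1) • e) = α • y + (α * t) • e by module]
      exact hadd _ (C.smul_mem hα hy) _ (by positivity)
    refine hT_mono a b _ (hadd x hx _ (by positivity)) _ hαy ?_
    rwa [show α • (y + (t * 1) • e) - (x + (t * α) • e) = α • y - x by module]

/-- By the Lipschitz estimate only `x = z` matters, and there compactness of `A × B` gives the
bound. -/
lemma IsConeFamily.exists_ratio_le [CompactSpace A] [CompactSpace B] (hT : IsConeFamily C T)
    (hC : IsProperCone C) {z : E} (hz : z ∈ interior (C : Set E)) :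
    ∃ K : ℝ, 0 < K ∧ ∀ a b, ∀ x ∈ C, coneRatio C (T a b x) z ≤ K * coneRatio C x z := by
  have hzC : z ∈ C := interior_subset hz
  have hcont : Continuous (fun p : A × B => coneRatio C (T p.1 p.2 z) z) := by
    have h1 : Continuous (fun p : A × B => T p.1 p.2 z) := by
      rw [← continuousOn_univ]
      exact hT.continuousOn.comp (f := fun p : A × B => (p.1, p.2, z)) (by fun_prop)
        fun p _ => hzC
    exact (hC.isHomMono_coneRatio hz).continuousOn.comp_continuous h1 fun p => hT.mem _ _ _ hzC
  obtain ⟨K, hK⟩ := (isCompact_range hcont).bddAbove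
  refine ⟨max K 1, by positivity, fun a b x hx => ?_⟩
  have hTV : IsHomMono C (fun x => coneRatio C (T a b x) z) := by
    have hV := hC.isHomMono_coneRatio hz
    have hc : ContinuousOn (T a b) (C : Set E) :=
      hT.continuousOn.comp (f := fun x : E => (a, b, x)) (by fun_prop) fun x hx => hx
    exact ⟨hV.continuousOn.comp hc fun x hx => hT.mem _ _ _ hx,
      fun x hx => coneRatio_nonneg _ _, fun x hx y hy α hα h =>
        hV.le_mul _ (hT.mem _ _ _ hx) _ (hT.mem _ _ _ hy) α hα (hT.smul_sub_mem a b x hx y hy α hα h)⟩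
  refine (hTV.le_coneRatio_mul hC hx hz).trans ?_
  rw [mul_comm]
  exact mul_le_mul_of_nonneg_right ((hK ⟨(a, b), rfl⟩).trans (le_max_left _ _))
    (coneRatio_nonneg x z)

/-- The images of `z` form a compact subset of the interior, so they stay at a uniform distance from
the boundary. -/
lemma IsConeFamily.exists_smul_sub_mem [CompactSpace A] [CompactSpace B] (hT : IsConeFamily C T)
    (z : E) (hz : z ∈ interior (C : Set E)) :
    ∃ κ : ℝ, 0 < κ ∧ ∀ a b, κ • T a b z - z ∈ C := by
  have hzC : z ∈ C := interior_subset hz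
  have h1 : Continuous (fun p : A × B => T p.1 p.2 z) := by
    rw [← continuousOn_univ]
    exact hT.continuousOn.comp (f := fun p : A × B => (p.1, p.2, z)) (by fun_prop)
      fun p _ => hzC
  obtain ⟨δ, hδ, hsub⟩ := (isCompact_range h1).exists_cthickening_subset_open isOpen_interior
    (by rintro _ ⟨p, rfl⟩; exact hT.mem_interior _ _ _ hz)
  -- Subtracting `(δ / (‖z‖ + 1)) • z` moves a point by at most `δ`; the `+ 1` keeps the denominator
  -- positive.
  refine ⟨(‖z‖ + 1) / δ, by positivity, fun a b => ?_⟩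
  have h2 : T a b z - (δ / (‖z‖ + 1)) • z ∈ C := by
    refine interior_subset (hsub (Metric.mem_cthickening_of_dist_le _ (T a b z) _ _
      ⟨(a, b), rfl⟩ ?_))
    rw [dist_eq_norm, sub_sub_cancel_left, norm_neg, norm_smul, Real.norm_eq_abs,
      abs_of_pos (by positivity), div_mul_eq_mul_div, div_le_iff₀ (by positivity)]
    nlinarith [norm_nonneg z]
  have h3 := C.smul_mem (show 0 < (‖z‖ + 1) / δ by positivity) h2
  rwa [smul_sub, smul_smul, div_mul_div_cancel₀ hδ.ne', div_self (by positivity), one_smul] at h3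

/-! ### The Shapley operator and its optimal actions -/

/-- The Shapley operator on real-valued functions. -/
noncomputable def realShapley (T : A → B → E → E) (V : E → ℝ) (x : E) : ℝ :=
  sInf ((fun a => sSup ((fun b => V (T a b x)) '' univ)) '' univ)

lemma IsConeFamily.continuous_comp (hT : IsConeFamily C T) {V : E → ℝ} (hV : IsHomMono C V) :
    Continuous (fun p : ↥(C : Set E) × A × B => V (T p.2.1 p.2.2 p.1)) := by
  refine hV.continuousOn.comp_continuous ?_ fun p => hT.mem _ _ _ p.1.2
  exact hT.continuousOn.comp_continuous
    (f := fun p : ↥(C : Set E) × A × B => (p.2.1, p.2.2, (p.1 : E))) (by fun_prop) fun p => p.1.2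

lemma IsConeFamily.continuous_sSup [CompactSpace B] (hT : IsConeFamily C T) {V : E → ℝ} (hV : IsHomMono C V) :
    Continuous (fun p : ↥(C : Set E) × A => sSup ((fun b => V (T p.2 b p.1)) '' univ)) :=
  isCompact_univ.continuous_sSup (f := fun (p : ↥(C : Set E) × A) b => V (T p.2 b p.1))
    ((hT.continuous_comp hV).comp
      (f := fun q : (↥(C : Set E) × A) × B => (q.1.1, q.1.2, q.2)) (by fun_prop))

variable [CompactSpace A] [CompactSpace B]

lemma IsConeFamily.exists_forall_le_realShapley [Nonempty A] (hT : IsConeFamily C T) {V : E → ℝ}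
    (hV : IsHomMono C V) {x : E} (hx : x ∈ C) : ∃ a, ∀ b, V (T a b x) ≤ realShapley T V x := by
  obtain ⟨a, -, ha⟩ := (isCompact_univ (X := A)).exists_sInf_image_eq univ_nonempty
    (((hT.continuous_sSup hV).comp (f := fun a : A => ((⟨x, hx⟩ : ↥(C : Set E)), a))
      (by fun_prop)).continuousOn)
  refine ⟨a, fun b => ?_⟩
  have hb : Continuous (fun b => V (T a b x)) :=
    (hT.continuous_comp hV).comp (f := fun b : B => ((⟨x, hx⟩ : ↥(C : Set E)), a, b)) (by fun_prop)
  exact (le_csSup (isCompact_univ.bddAbove_image hb.continuousOn)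
    (mem_image_of_mem _ (mem_univ b))).trans_eq ha.symm

lemma IsConeFamily.exists_realShapley_le [Nonempty B] (hT : IsConeFamily C T) {V : E → ℝ}
    (hV : IsHomMono C V) {x : E} (hx : x ∈ C) (a : A) : ∃ b, realShapley T V x ≤ V (T a b x) := by
  have hb : Continuous (fun b => V (T a b x)) :=
    (hT.continuous_comp hV).comp (f := fun b : B => ((⟨x, hx⟩ : ↥(C : Set E)), a, b)) (by fun_prop)
  obtain ⟨b, -, hb⟩ := (isCompact_univ (X := B)).exists_sSup_image_eq univ_nonempty hb.continuousOn
  refine ⟨b, (csInf_le (isCompact_univ.bddBelow_image ?_) (mem_image_of_mem _ (mem_univ a))).trans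
    hb.le⟩
  exact ((hT.continuous_sSup hV).comp (f := fun a : A => ((⟨x, hx⟩ : ↥(C : Set E)), a))
    (by fun_prop)).continuousOn

lemma IsConeFamily.realShapley_le [Nonempty B] (hT : IsConeFamily C T) {V : E → ℝ}
    (hV : IsHomMono C V) {x : E} (hx : x ∈ C) {c : ℝ} {a : A} (h : ∀ b, V (T a b x) ≤ c) :
    realShapley T V x ≤ c := by
  obtain ⟨b, hb⟩ := hT.exists_realShapley_le hV hx a
  exact hb.trans (h b)

variable [Nonempty A] [Nonempty B]

lemma IsConeFamily.isHomMono_realShapley (hT : IsConeFamily C T) {V : E → ℝ}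
    (hV : IsHomMono C V) : IsHomMono C (realShapley T V) where
  continuousOn := by
    rw [continuousOn_iff_continuous_domRestrict]
    exact isCompact_univ.continuous_sInf
      (f := fun (x : (C : Set E)) a => sSup ((fun b => V (T a b x)) '' univ)) (hT.continuous_sSup hV)
  nonneg x hx := by
    obtain ⟨a, ha⟩ := hT.exists_forall_le_realShapley hV hx
    exact (hV.nonneg _ (hT.mem a (Classical.arbitrary B) x hx)).trans (ha _)
  le_mul x hx y hy α hα h := by
    -- Min's optimal action at `y` is used at `x`.
    obtain ⟨a, ha⟩ := hT.exists_forall_le_realShapley hV hy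
    refine hT.realShapley_le hV hx (a := a) fun b => ?_
    exact (hV.le_mul _ (hT.mem a b x hx) _ (hT.mem a b y hy) α hα
      (hT.smul_sub_mem a b x hx y hy α hα h)).trans (mul_le_mul_of_nonneg_left (ha b) hα.le)

/-! ### Finite horizon values and their growth rate -/

/-- The exponential of the value of the game in finite horizon. -/
noncomputable def horizonValue (C : ConvexCone ℝ E) (T : A → B → E → E) (z : E) : ℕ → E → ℝ
  | 0 => fun x => coneRatio C x z
  | n + 1 => realShapley T (horizonValue C T z n)

variable {z : E}

lemma IsConeFamily.isHomMono_horizonValue (hT : IsConeFamily C T) (hC : IsProperCone C)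
    (hz : z ∈ interior (C : Set E)) (n : ℕ) : IsHomMono C (horizonValue C T z n) := by
  induction n with
  | zero => exact hC.isHomMono_coneRatio hz
  | succ n ih => exact hT.isHomMono_realShapley ih

/-- The base case is the Lipschitz estimate for `horizonValue C T z m`; the inequality then passes
through the monotone Shapley operator. -/
lemma IsConeFamily.horizonValue_add_le (hT : IsConeFamily C T) (hC : IsProperCone C)
    (hz : z ∈ interior (C : Set E)) (m n : ℕ) : ∀ x ∈ C,
    horizonValue C T z (m + n) x ≤ horizonValue C T z m z * horizonValue C T z n x := by
  induction n with
  | zero =>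
    intro x hx
    rw [mul_comm]
    exact (hT.isHomMono_horizonValue hC hz m).le_coneRatio_mul hC hx hz
  | succ n ih =>
    intro x hx
    obtain ⟨a, ha⟩ := hT.exists_forall_le_realShapley (hT.isHomMono_horizonValue hC hz n) hx
    refine hT.realShapley_le (hT.isHomMono_horizonValue hC hz (m + n)) hx (a := a) fun b => ?_
    exact (ih _ (hT.mem a b x hx)).trans (mul_le_mul_of_nonneg_left (ha b)
      ((hT.isHomMono_horizonValue hC hz m).nonneg z (interior_subset hz)))

/-- Whatever the actions, `z ≤ κ T z`, so one turn costs at most a factor `κ`. This keeps the growth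
rate finite. -/
lemma IsConeFamily.exists_pow_le_horizonValue [Nontrivial E] (hT : IsConeFamily C T)
    (hC : IsProperCone C) (hz : z ∈ interior (C : Set E)) :
    ∃ κ : ℝ, 0 < κ ∧ ∀ n : ℕ, κ ^ n ≤ horizonValue C T z n z := by
  obtain ⟨κ, hκ, h⟩ := hT.exists_smul_sub_mem z hz
  have hzC : z ∈ C := interior_subset hz
  refine ⟨κ⁻¹, inv_pos.2 hκ, fun n => ?_⟩
  induction n with
  | zero => exact (pow_zero _).trans_le (hC.coneRatio_self hz).ge
  | succ n ih =>
    have hV := hT.isHomMono_horizonValue hC hz n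
    obtain ⟨a, ha⟩ := hT.exists_forall_le_realShapley hV hzC
    obtain ⟨b⟩ := ‹Nonempty B›
    refine le_trans ?_ (ha b)
    have := hV.le_mul z hzC _ (hT.mem a b z hzC) κ hκ (h a b)
    rw [pow_succ', inv_mul_le_iff₀ hκ]
    exact ih.trans this

lemma IsConeFamily.horizonValue_pos [Nontrivial E] (hT : IsConeFamily C T)
    (hC : IsProperCone C) (hz : z ∈ interior (C : Set E)) (n : ℕ) :
    0 < horizonValue C T z n z := by
  obtain ⟨κ, hκ, h⟩ := hT.exists_pow_le_horizonValue hC hz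
  exact (pow_pos hκ n).trans_le (h n)

lemma IsConeFamily.subadditive_log_horizonValue [Nontrivial E] (hT : IsConeFamily C T)
    (hC : IsProperCone C) (hz : z ∈ interior (C : Set E)) :
    Subadditive (fun n => Real.log (horizonValue C T z n z)) := by
  intro m n
  rw [← Real.log_mul (hT.horizonValue_pos hC hz m).ne' (hT.horizonValue_pos hC hz n).ne']
  exact Real.log_le_log (hT.horizonValue_pos hC hz _)
    (hT.horizonValue_add_le hC hz m n z (interior_subset hz))

lemma IsConeFamily.bddBelow_log_horizonValue [Nontrivial E] (hT : IsConeFamily C T)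
    (hC : IsProperCone C) (hz : z ∈ interior (C : Set E)) :
    BddBelow (range fun n : ℕ => Real.log (horizonValue C T z n z) / n) := by
  obtain ⟨κ, hκ, h⟩ := hT.exists_pow_le_horizonValue hC hz
  -- The `0` accounts for the term `n = 0`, where division by zero gives `0`.
  refine ⟨min (Real.log κ) 0, ?_⟩
  rintro _ ⟨n, rfl⟩
  rcases n.eq_zero_or_pos with rfl | hn
  · simp
  · refine (min_le_left _ _).trans ?_
    rw [le_div_iff₀ (by exact_mod_cast hn), mul_comm, ← Real.log_pow]
    exact Real.log_le_log (pow_pos hκ n) (h n)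

end ConeFamily

/-! ### The strategies of both players and the value -/

section Value

variable {E : Type*} [NormedAddCommGroup E] [NormedSpace ℝ E] {C : ConvexCone ℝ E}
  {A B : Type*} {T : A → B → E → E}

/-- A distance-like function `v` with `Sv ≤ l + v` bounds the payoff that Max can enforce. -/
lemma IsProperCone.exists_minStrategy_payoff_le [Nontrivial E] (hC : IsProperCone C)
    (hT : ∀ a b, Set.MapsTo (T a b) (interior (C : Set E)) (interior (C : Set E)))
    (x₀ : interior (C : Set E)) {l : ℝ} {v : E → EReal} (hv : v ∈ distanceLikeOnCone C)
    (h : ∀ x ∈ C, shapley T v x ≤ (l : EReal) + v x) {ε : ℝ} (hε : 0 < ε) :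
    ∃ (σ : MinStrategy (interior (C : Set E)) A B) (N : ℕ), 1 ≤ N ∧ ∀ k ≥ N, ∀ τ,
      payoff (funk C) (fun a b => (hT a b).restrict) x₀ σ τ k / k ≤ l + ε := by
  obtain ⟨-, f, ⟨-, z, α, hα⟩, hvf⟩ := hv
  have hstep : ∀ x : interior (C : Set E), ∃ a, ∀ b,
      f ⟨T a b x, hT a b x.2⟩ ≤ (l + ε / 2) + f x := by
    intro x
    -- The slack `ε / 2` makes the inequality strict, so some action of Min realises it without any
    -- attainment of the infimum.
    have h1 : shapley T v x < ((l + ε / 2 + f x : ℝ) : EReal) := by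
      refine (h x (interior_subset x.2)).trans_lt ?_
      rw [hvf, ← EReal.coe_add, EReal.coe_lt_coe_iff]
      linarith
    obtain ⟨a, ha⟩ := iInf_lt_iff.1 h1
    refine ⟨a, fun b => ?_⟩
    have h2 := (le_iSup (fun b => v (T a b x)) b).trans ha.le
    exact EReal.coe_le_coe_iff.1 ((hvf ⟨T a b x, hT a b x.2⟩).symm.trans_le h2)
  obtain ⟨σ, hσ⟩ := exists_minStrategy (fun a b => (hT a b).restrict) f _ hstep x₀
  -- After `N` turns the other `ε / 2` per turn absorbs the constants: the initial `f x₀`, the lower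
  -- bound `α`, and the change of base point from `z` to `x₀`.
  obtain ⟨N, hN⟩ := exists_nat_ge ((f x₀ - α + funk C z x₀) / (ε / 2))
  refine ⟨σ, max N 1, le_max_right _ _, fun k hk τ => ?_⟩
  have hk1 : (1 : ℝ) ≤ k := by exact_mod_cast (le_max_right N 1).trans hk
  have hkN : (N : ℝ) ≤ k := by exact_mod_cast (le_max_left N 1).trans hk
  have h1 := (div_le_iff₀ (half_pos hε)).1 (hN.trans hkN)
  rw [div_le_iff₀ (by linarith)]
  refine (hC.funk_triangle _ z x₀).trans ?_
  have h2 := hα (play (fun a b => (hT a b).restrict) x₀ σ τ k).2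
  have h3 := hσ τ k
  linarith

variable [TopologicalSpace A] [TopologicalSpace B]
  [CompactSpace A] [Nonempty A] [CompactSpace B] [Nonempty B] {z : E}

/-- Any `l` above the growth rate of the finite horizon values is attained by some distance-like
function `v` with `Sv ≤ l + v`. -/
lemma IsConeFamily.exists_shapley_le [Nontrivial E] (hT : IsConeFamily C T)
    (hC : IsProperCone C) (hz : z ∈ interior (C : Set E)) {l : ℝ}
    (hl : (hT.subadditive_log_horizonValue hC hz).lim < l) :
    ∃ v ∈ distanceLikeOnCone C, ∀ x ∈ C, shapley T v x ≤ (l : EReal) + v x := by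
  have hev := ((hT.subadditive_log_horizonValue hC hz).tendsto_lim
    (hT.bddBelow_log_horizonValue hC hz)).eventually_lt_const hl
  obtain ⟨n, hn, hn1⟩ := (hev.and (eventually_ge_atTop 1)).exists
  have hn0 : (0 : ℝ) < n := by exact_mod_cast hn1
  set s := horizonValue C T z n z with hs
  have hspos : 0 < s := hT.horizonValue_pos hC hz n
  have hsn : s < Real.exp (n * l) := by
    rw [div_lt_iff₀ hn0, mul_comm] at hn
    exact (Real.log_lt_iff_lt_exp hspos).1 hn
  obtain ⟨K, hK, hKh⟩ := hT.exists_ratio_le hC hz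
  -- The largest perturbation that the gap `s < exp (n l)` pays for: after `n` turns it has grown to
  -- `exp (n l) - s` times the ratio.
  set δ := (Real.exp (n * l) - s) / K ^ n with hδ
  have hδpos : 0 < δ := div_pos (sub_pos.2 hsn) (pow_pos hK n)
  set U : ℕ → E → ℝ := fun k x => horizonValue C T z k x + δ * K ^ k * coneRatio C x z with hU
  have hUmono : ∀ k, IsHomMono C (U k) := fun k =>
    (hT.isHomMono_horizonValue hC hz k).add ((hC.isHomMono_coneRatio hz).const_mul (by positivity))
  have hUstep : ∀ k, ∀ x ∈ C, ∃ a, ∀ b, U k (T a b x) ≤ U (k + 1) x := by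
    intro k x hx
    obtain ⟨a, ha⟩ := hT.exists_forall_le_realShapley (hT.isHomMono_horizonValue hC hz k) hx
    refine ⟨a, fun b => add_le_add (ha b) ?_⟩
    calc δ * K ^ k * coneRatio C (T a b x) z ≤ δ * K ^ k * (K * coneRatio C x z) := by
          gcongr
          exact hKh a b x hx
      _ = δ * K ^ (k + 1) * coneRatio C x z := by ring
  have hUn : ∀ x ∈ C, U n x ≤ Real.exp (n * l) * U 0 x := by
    intro x hx
    have h1 := (hT.isHomMono_horizonValue hC hz n).le_coneRatio_mul hC hx hz
    have h2 : δ * K ^ n = Real.exp (n * l) - s := div_mul_cancel₀ _ (pow_pos hK n).ne'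
    have h3 : (0 : ℝ) ≤ Real.exp (n * l) * (δ * coneRatio C x z) :=
      mul_nonneg (Real.exp_pos _).le (mul_nonneg hδpos.le (coneRatio_nonneg x z))
    have h4 : U 0 x = coneRatio C x z + δ * K ^ 0 * coneRatio C x z := rfl
    simp only [h4, pow_zero, mul_one]
    simp only [hU, h2]
    linarith
  have hne : (Finset.range n).Nonempty := Finset.nonempty_range_iff.2 (by omega)
  set V : E → ℝ := fun x => (Finset.range n).inf' hne fun k => Real.exp (-(k * l)) * U k x with hV
  have hVmono : IsHomMono C V :=
    IsHomMono.finset_inf' hne fun k _ => (hUmono k).const_mul (Real.exp_pos _).le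
  have hVle : ∀ k < n, ∀ x, V x ≤ Real.exp (-(k * l)) * U k x := fun k hk x =>
    Finset.inf'_le _ (Finset.mem_range.2 hk)
  have hVstep : ∀ x ∈ C, ∃ a, ∀ b, V (T a b x) ≤ Real.exp l * V x := by
    intro x hx
    obtain ⟨k, hk, hkx⟩ := (Finset.range n).exists_mem_eq_inf' hne
      fun k => Real.exp (-(k * l)) * U k x
    have hk := Finset.mem_range.1 hk
    have hkx : V x = Real.exp (-(k * l)) * U k x := hkx
    have hstep : ∀ j < n, ∃ a, ∀ b,
        V (T a b x) ≤ Real.exp l * (Real.exp (-((j + 1 : ℕ) * l)) * U (j + 1) x) := by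
      intro j hj
      obtain ⟨a, ha⟩ := hUstep j x hx
      refine ⟨a, fun b => (hVle j hj _).trans ?_⟩
      rw [← mul_assoc, ← Real.exp_add, show l + -((j + 1 : ℕ) * l) = -(j * l) by push_cast; ring]
      exact mul_le_mul_of_nonneg_left (ha b) (Real.exp_pos _).le
    rw [hkx]
    -- If the minimum at `x` is attained at `k + 1`, Min plays for index `k`. If it is attained at
    -- `0`, the index wraps around to `n - 1` by means of `hUn`.
    rcases k with _ | k
    · obtain ⟨a, ha⟩ := hstep (n - 1) (by omega)
      refine ⟨a, fun b => (ha b).trans (mul_le_mul_of_nonneg_left ?_ (Real.exp_pos _).le)⟩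
      rw [Nat.sub_add_cancel hn1, Real.exp_neg, inv_mul_le_iff₀ (Real.exp_pos _)]
      simpa using hUn x hx
    · exact hstep k (by omega)
  obtain ⟨c, hc, hcV⟩ : ∃ c : ℝ, 0 < c ∧ ∀ x ∈ C, c * coneRatio C x z ≤ V x := by
    refine ⟨(Finset.range n).inf' hne fun k => Real.exp (-(k * l)) * (δ * K ^ k), ?_, ?_⟩
    · rw [Finset.lt_inf'_iff]
      intro k _
      positivity
    · intro x hx
      refine Finset.le_inf' _ _ fun k hk => ?_
      calc _ ≤ Real.exp (-(k * l)) * (δ * K ^ k) * coneRatio C x z :=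
            mul_le_mul_of_nonneg_right (Finset.inf'_le _ hk) (coneRatio_nonneg x z)
        _ ≤ Real.exp (-(k * l)) * U k x := by
            rw [mul_assoc]
            exact mul_le_mul_of_nonneg_left
              (le_add_of_nonneg_left ((hT.isHomMono_horizonValue hC hz k).nonneg x hx))
              (Real.exp_pos _).le
  refine ⟨_, hVmono.log_mem_distanceLikeOnCone hC ⟨z, hz⟩ hc hcV, fun x hx => ?_⟩
  obtain ⟨a, ha⟩ := hVstep x hx
  refine (iInf_le _ a).trans (iSup_le fun b => ?_)
  calc ENNReal.log (ENNReal.ofReal (V (T a b x)))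
      ≤ ENNReal.log (ENNReal.ofReal (Real.exp l * V x)) :=
        ENNReal.log_le_log (ENNReal.ofReal_le_ofReal (ha b))
    _ = (l : EReal) + ENNReal.log (ENNReal.ofReal (V x)) := by
        rw [ENNReal.ofReal_mul (Real.exp_pos l).le, ENNReal.log_mul_add,
          ENNReal.log_ofReal_of_pos (Real.exp_pos l), Real.log_exp]

/-- Limits of normalised finite horizon values along an ultrafilter of record times: they are
nondecreasing along an optimal play of Max, and decay geometrically. -/
lemma IsConeFamily.exists_limit_horizonValue [Nontrivial E] (hT : IsConeFamily C T)
    (hC : IsProperCone C) (hz : z ∈ interior (C : Set E)) {m : ℝ}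
    (hm : m < (hT.subadditive_log_horizonValue hC hz).lim) :
    ∃ u : ℕ → interior (C : Set E) → ℝ, u 0 ⟨z, hz⟩ = 1 ∧
      (∀ j x, u j x ≤ Real.exp (-(j * m)) * coneRatio C x z) ∧
      ∀ j (x : interior (C : Set E)) a, ∃ b, ∀ hx : T a b x ∈ interior (C : Set E),
        u j x ≤ u (j + 1) ⟨T a b x, hx⟩ := by
  set V := horizonValue C T z
  have hV : ∀ n, IsHomMono C (V n) := hT.isHomMono_horizonValue hC hz
  have hspos : ∀ n, 0 < V n z := hT.horizonValue_pos hC hz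
  set r := (hT.subadditive_log_horizonValue hC hz).lim
  have htop : Tendsto (fun n : ℕ => Real.log (V n z) - n * m) atTop atTop := by
    have h1 : Tendsto (fun n : ℕ => (n : ℝ) * (r - m)) atTop atTop :=
      tendsto_natCast_atTop_atTop.atTop_mul_const (sub_pos.2 hm)
    refine tendsto_atTop_mono' _ ?_ h1
    filter_upwards [eventually_ge_atTop 1] with n hn
    have h2 := (hT.subadditive_log_horizonValue hC hz).lim_le_div
      (hT.bddBelow_log_horizonValue hC hz) (show n ≠ 0 by omega)
    rw [le_div_iff₀ (by exact_mod_cast hn)] at h2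
    have h3 : r * n ≤ Real.log (V n z) := h2
    linarith
  -- Record times of a sequence tending to infinity: there are infinitely many, and at each of them
  -- all earlier values are controlled at once.
  set R : Set ℕ := {n | ∀ k < n, Real.log (V k z) - k * m < Real.log (V n z) - n * m}
  have hR : (atTop ⊓ 𝓟 R).NeBot :=
    frequently_mem_iff_neBot.1 (frequently_high_scores htop)
  set 𝓤 : Ultrafilter ℕ := Ultrafilter.of (atTop ⊓ 𝓟 R)
  have h𝓤 : (𝓤 : Filter ℕ) ≤ atTop ⊓ 𝓟 R := Ultrafilter.of_le _
  have h𝓤top : (𝓤 : Filter ℕ) ≤ atTop := h𝓤.trans inf_le_left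
  have h𝓤R : ∀ᶠ n : ℕ in (𝓤 : Filter ℕ), n ∈ R := (h𝓤.trans inf_le_right) (mem_principal_self R)
  have hbound : ∀ j : ℕ, ∀ x ∈ C, ∀ᶠ n : ℕ in (𝓤 : Filter ℕ), V (n - j) x / V n z ∈
      Icc 0 (Real.exp (-(j * m)) * coneRatio C x z) := by
    intro j x hx
    filter_upwards [h𝓤R, h𝓤top (eventually_ge_atTop j)] with n hn hj
    refine ⟨div_nonneg ((hV _).nonneg x hx) (hspos n).le, ?_⟩
    have h1 : Real.log (V (n - j) z) - (n - j : ℕ) * m ≤ Real.log (V n z) - n * m := by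
      rcases Nat.eq_zero_or_pos j with rfl | hj0
      · simp
      · exact (hn (n - j) (by omega)).le
    rw [Nat.cast_sub hj] at h1
    have h2 : V (n - j) z ≤ Real.exp (-(j * m)) * V n z := by
      rw [← Real.log_le_log_iff (hspos _) (mul_pos (Real.exp_pos _) (hspos n)),
        Real.log_mul (Real.exp_pos _).ne' (hspos n).ne', Real.log_exp]
      linarith
    rw [div_le_iff₀ (hspos n)]
    calc V (n - j) x ≤ coneRatio C x z * V (n - j) z := (hV _).le_coneRatio_mul hC hx hz
      _ ≤ coneRatio C x z * (Real.exp (-(j * m)) * V n z) :=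
          mul_le_mul_of_nonneg_left h2 (coneRatio_nonneg x z)
      _ = _ := by ring
  have hlim : ∀ (j : ℕ) (x : interior (C : Set E)),
      ∃ y ∈ Icc 0 (Real.exp (-(j * m)) * coneRatio C x z),
        Tendsto (fun n : ℕ => V (n - j) x / V n z) 𝓤 (𝓝 y) := by
    intro j x
    exact isCompact_Icc.ultrafilter_le_nhds'
      (𝓤.map fun n : ℕ => V (n - j) x / V n z) (hbound j x (interior_subset x.2))
  choose u hu hulim using hlim
  refine ⟨u, ?_, fun j x => (hu j x).2, fun j x a => ?_⟩
  · refine tendsto_nhds_unique (hulim 0 ⟨z, hz⟩) (tendsto_const_nhds.congr fun n => ?_)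
    exact (div_self (hspos n).ne').symm
  · have hxC : (x : E) ∈ C := interior_subset x.2
    choose b hb using fun n => hT.exists_realShapley_le (hV n) hxC a
    -- The optimal replies depend on the remaining horizon; Max plays their limit along the
    -- ultrafilter.
    obtain ⟨b₀, -, hb₀⟩ := (isCompact_univ (X := B)).ultrafilter_le_nhds'
      (𝓤.map fun n => b (n - (j + 1))) univ_mem
    have hb₀ : Tendsto (fun n => b (n - (j + 1))) 𝓤 (𝓝 b₀) := hb₀
    refine ⟨b₀, fun hx => ?_⟩
    set y := T a b₀ x
    have hcont : Continuous fun b => T a b x :=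
      hT.continuousOn.comp_continuous (f := fun b : B => (a, b, (x : E))) (by fun_prop)
        fun _ => hxC
    -- This replaces equicontinuity: every `V k` changes by at most this ratio when the approximate
    -- next state is replaced by `y`, uniformly in `k`.
    have hratio : Tendsto (fun n => coneRatio C (T a (b (n - (j + 1))) x) y) 𝓤 (𝓝 1) := by
      have h1 := (hC.isHomMono_coneRatio hx).continuousOn.comp_continuous hcont
        fun b => hT.mem a b x hxC
      have h2 := (h1.tendsto b₀).comp hb₀
      rwa [show ((fun x => coneRatio C x y) ∘ fun b => T a b x) b₀ = 1 from
        hC.coneRatio_self hx] at h2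
    have h3 := hratio.mul (hulim (j + 1) ⟨y, hx⟩)
    rw [one_mul] at h3
    refine le_of_tendsto_of_tendsto (hulim j x) h3 ?_
    filter_upwards [h𝓤top (eventually_ge_atTop (j + 1))] with n hn
    have h4 := hb (n - (j + 1))
    have h5 : realShapley T (V (n - (j + 1))) x = V (n - j) x := by
      rw [show n - j = n - (j + 1) + 1 by omega]
      rfl
    rw [h5] at h4
    rw [← mul_div_assoc]
    exact div_le_div_of_nonneg_right (h4.trans
      ((hV _).le_coneRatio_mul hC (hT.mem a _ x hxC) hx)) (hspos n).le

/-- Max guarantees any growth rate below that of the finite horizon values. -/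
lemma IsConeFamily.exists_maxStrategy_le_payoff [Nontrivial E] (hT : IsConeFamily C T)
    (hC : IsProperCone C)
    (hT_int : ∀ a b, Set.MapsTo (T a b) (interior (C : Set E)) (interior (C : Set E)))
    (x₀ : interior (C : Set E)) {m : ℝ}
    (hm : m < (hT.subadditive_log_horizonValue hC x₀.2).lim) :
    ∃ τ : MaxStrategy (interior (C : Set E)) A B, ∀ k : ℕ, 1 ≤ k → ∀ σ,
      m ≤ payoff (funk C) (fun a b => (hT_int a b).restrict) x₀ σ τ k / k := by
  obtain ⟨u, hu0, hule, hustep⟩ := hT.exists_limit_horizonValue hC x₀.2 hm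
  obtain ⟨τ, hτ⟩ := exists_maxStrategy (fun a b => (hT_int a b).restrict) u (fun k x a => by
    obtain ⟨b, hb⟩ := hustep k x a
    exact ⟨b, hb (hT_int a b x.2)⟩) x₀
  refine ⟨τ, fun k hk σ => ?_⟩
  rw [le_div_iff₀ (by exact_mod_cast hk)]
  set x := (play (fun a b => (hT_int a b).restrict) x₀ σ τ k).2 with hx
  have h1 : 1 ≤ Real.exp (-(k * m)) * coneRatio C x x₀ :=
    hu0.symm.le.trans ((hτ σ k).trans (hule k x))
  rw [Real.exp_neg, ← div_eq_inv_mul, le_div_iff₀ (Real.exp_pos _), one_mul] at h1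
  rw [payoff, ← hx, funk_eq_log, mul_comm]
  exact (Real.le_log_iff_exp_le (hC.coneRatio_pos x.2 x₀.2)).2 h1

/-- The growth rate of the finite horizon values is the uniform value. -/
lemma IsConeFamily.isUniformValue_lim [Nontrivial E] (hT : IsConeFamily C T)
    (hC : IsProperCone C)
    (hT_int : ∀ a b, Set.MapsTo (T a b) (interior (C : Set E)) (interior (C : Set E)))
    (x₀ : interior (C : Set E)) :
    IsUniformValue (funk C) (fun a b => (hT_int a b).restrict) x₀
      (hT.subadditive_log_horizonValue hC x₀.2).lim := by
  intro ε hε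
  obtain ⟨v, hv, hvS⟩ := hT.exists_shapley_le hC x₀.2 (lt_add_of_pos_right _ (half_pos hε))
  obtain ⟨σε, N, hN1, hσ⟩ := hC.exists_minStrategy_payoff_le hT_int x₀ hv hvS (half_pos hε)
  obtain ⟨τε, hτ⟩ := hT.exists_maxStrategy_le_payoff hC hT_int x₀ (sub_lt_self _ hε)
  refine ⟨σε, τε, N, fun k hk σ τ => ⟨?_, hτ k (hN1.trans hk) σ⟩⟩
  linarith [hσ k hk τ]

/-- The uniform value is the infimum of the numbers `l` such that `Sv ≤ l + v` for some
distance-like `v`. -/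
lemma IsConeFamily.isGLB_lim [Nontrivial E] (hT : IsConeFamily C T)
    (hC : IsProperCone C) (x₀ : interior (C : Set E)) :
    IsGLB {l : ℝ | ∃ v ∈ distanceLikeOnCone C, ∀ x ∈ C, shapley T v x ≤ (l : EReal) + v x}
      (hT.subadditive_log_horizonValue hC x₀.2).lim := by
  have hT_int : ∀ a b, Set.MapsTo (T a b) (interior (C : Set E)) (interior (C : Set E)) :=
    fun a b x hx => hT.mem_interior a b x hx
  -- Every `l` above the growth rate lies in the set, so no larger lower bound exists. That the
  -- growth rate is a lower bound follows by playing Min's strategy from `v` against Max's.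
  refine ⟨?_, fun r hr => le_of_forall_gt_imp_ge_of_dense fun l hl =>
    hr (hT.exists_shapley_le hC x₀.2 hl)⟩
  rintro l ⟨v, hv, hvS⟩
  refine le_of_forall_pos_le_add fun ε hε => ?_
  obtain ⟨σ, N, hN1, hσ⟩ := hC.exists_minStrategy_payoff_le hT_int x₀ hv hvS (half_pos hε)
  obtain ⟨τ, hτ⟩ := hT.exists_maxStrategy_le_payoff hC hT_int x₀ (sub_lt_self _ (half_pos hε))
  linarith [hσ N le_rfl τ, hτ N hN1 σ]

end Value

end EscapeRate

theorem mainTheorem5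
    {E : Type*} [NormedAddCommGroup E] [NormedSpace ℝ E] [FiniteDimensional ℝ E] [Nontrivial E]
    (C : ConvexCone ℝ E) (hC : EscapeRate.IsProperCone C)
    {A B : Type*} [TopologicalSpace A] [CompactSpace A] [Nonempty A]
    [TopologicalSpace B] [CompactSpace B] [Nonempty B]
    (T : A → B → E → E)
    (hT_cone : ∀ a b, Set.MapsTo (T a b) (C : Set E) (C : Set E))
    (hT_int : ∀ a b, Set.MapsTo (T a b) (interior (C : Set E)) (interior (C : Set E)))
    (hT_mono : ∀ a b, ∀ x ∈ interior (C : Set E), ∀ y ∈ interior (C : Set E),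
      y - x ∈ C → T a b y - T a b x ∈ C)
    (hT_homog : ∀ a b, ∀ x ∈ interior (C : Set E), ∀ t : ℝ, 0 < t →
      T a b (t • x) = t • T a b x)
    (hT_cont : ContinuousOn (fun p : A × B × E => T p.1 p.2.1 p.2.2)
      {p : A × B × E | p.2.2 ∈ C})
    (x₀ : interior (C : Set E)) :
    (∃ ρ : ℝ, EscapeRate.IsUniformValue (EscapeRate.funk C)
      (fun a b => (hT_int a b).restrict) x₀ ρ) ∧
    ∀ ρ : ℝ, EscapeRate.IsUniformValue (EscapeRate.funk C)
      (fun a b => (hT_int a b).restrict) x₀ ρ →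
      IsGLB {l : ℝ | ∃ v ∈ EscapeRate.distanceLikeOnCone C,
        ∀ x ∈ C, EscapeRate.shapley T v x ≤ (l : EReal) + v x} ρ := by
  have hT := hC.isConeFamily hT_cone hT_int hT_mono hT_homog hT_cont
  have hval := hT.isUniformValue_lim hC hT_int x₀
  -- A real greatest lower bound also makes the set nonempty and bounded below, since the empty set
  -- has none in `ℝ`.
  exact ⟨⟨_, hval⟩, fun ρ hρ => hρ.unique hval ▸ hT.isGLB_lim hC x₀⟩
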